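/- Let $\Gamma$ be a finite simple graph with vertex set $V(\Gamma)$ and edge set $E(\Gamma)$, let $A(\Gamma)=\langle V(\Gamma)\mid vw=wv,\ (v,w)\in E(\Gamma)\rangle$ be its right-angled Artin group, and let $X(\Gamma)$ be the CAT(0) cube complex whose $1$-skeleton is the Cayley graph of $A(\Gamma)$ with respect to $V(\Gamma)$ and whose $2$-cubes are the squares with corners $g,\,gv,\,gvw=gwv,\,gw$ for $g\in A(\Gamma)$ and $(v,w)\in E(\Gamma)$. Let $\mathcal{H}$ be the set of hyperplanes of $X(\Gamma)$, that is, the set of classes of edges of $X(\Gamma)$ under the equivalence relation generated by being opposite edges of a $2$-cube. The group $A(\Gamma)$ acts on $\mathcal{H}$ via left multiplication on $X(\Gamma)$. Give the countable set $\mathcal{H}$ the discrete Borel structure and $\mathcal{H}^{\mathbb{N}}$ the product Borel structure, which makes it a standard Borel space. Define the action $A(\Gamma)\curvearrowright\mathcal{H}^{\mathbb{N}}$ by $g\cdot(h_n)_{n\in\mathbb{N}}=(gh_n)_{n\in\mathbb{N}}$. Then its orbit equivalence relation $E$ (where $\vec h\,E\,\vec k$ if and only if $g\vec h=\vec k$ for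 some $g\in A(\Gamma)$) is smooth: $E$ is a Borel subset of $\mathcal{H}^{\mathbb{N}}\times\mathcal{H}^{\mathbb{N}}$, and there exist a standard Borel space $Y$ and a Borel map $f\colon\mathcal{H}^{\mathbb{N}}\to Y$ such that for all $\vec h,\vec k\in\mathcal{H}^{\mathbb{N}}$, $\vec h\,E\,\vec k\iff f(\vec h)=f(\vec k)$. -/

import Mathlib

universe u

/-- The right angled Artin group `A(Γ) = ⟨V(Γ) ∣ vw = wv, (v, w) ∈ E(Γ)⟩`. -/
abbrev RAAG {V : Type u} (Γ : SimpleGraph V) : Type u :=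
  PresentedGroup {r : FreeGroup V | ∃ v w : V, Γ.Adj v w ∧
    r = FreeGroup.of v * FreeGroup.of w * (FreeGroup.of v)⁻¹ * (FreeGroup.of w)⁻¹}

namespace RAAG

variable {V : Type u} {Γ : SimpleGraph V}

/-- The generator of `A(Γ)` given by a vertex of `Γ`. -/
def gen (Γ : SimpleGraph V) (v : V) : RAAG Γ := PresentedGroup.of v

instance [Countable V] : Countable (RAAG Γ) :=
  (PresentedGroup.mk_surjective _).countable

/-- The Cayley graph of `A(Γ)` with respect to `V(Γ)`, the `1`-skeleton of the CAT(0) cube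
complex `X(Γ)`: distinct `g, h` are adjacent iff `h = g v` or `g = h v` for some `v ∈ V(Γ)`. -/
def cayleyGraph (Γ : SimpleGraph V) : SimpleGraph (RAAG Γ) :=
  SimpleGraph.mulCayley (Set.range (gen Γ))

/-- The `1`-cubes of `X(Γ)`, i.e. the (unoriented) edges of the Cayley graph. -/
abbrev OneCube (Γ : SimpleGraph V) : Type u := (cayleyGraph Γ).edgeSet

/-- `a, b, c, d` are, in cyclic order, the corners of a `2`-cube of `X(Γ)`. The `2`-cubes of
`X(Γ)` are the lifts of the `2`-cubes of the Salvetti complex: there is one with corners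
`g, gv, gvw = gwv, gw` for every `g ∈ A(Γ)` and every edge `(v, w)` of `Γ`. -/
def IsTwoCube (a b c d : RAAG Γ) : Prop :=
  ∃ v w : V, Γ.Adj v w ∧ b = a * gen Γ v ∧ c = a * gen Γ v * gen Γ w ∧ d = a * gen Γ w

/-- `e` and `f` are opposite edges of a `2`-cube of `X(Γ)`. -/
def OppositeInTwoCube (e f : OneCube Γ) : Prop :=
  ∃ a b c d : RAAG Γ, IsTwoCube a b c d ∧
    ((e.1 = s(a, b) ∧ f.1 = s(d, c)) ∨ (e.1 = s(a, d) ∧ f.1 = s(b, c)))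

/-- The equivalence relation on the `1`-cubes of `X(Γ)` generated by being opposite in a
`2`-cube. -/
def parallelSetoid (Γ : SimpleGraph V) : Setoid (OneCube Γ) :=
  Relation.EqvGen.setoid OppositeInTwoCube

/-- The set `𝓗` of hyperplanes of `X(Γ)`, a hyperplane being identified with the class of the
`1`-cubes dual to it. -/
def Hyperplane (Γ : SimpleGraph V) : Type u := Quotient (parallelSetoid Γ)

/-- `A(Γ)` acts on the `1`-cubes of `X(Γ)` by left multiplication of the endpoints. -/
instance : MulAction (RAAG Γ) (OneCube Γ) where
  smul g e := ⟨e.1.map (g * ·), by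
    obtain ⟨e, he⟩ := e
    induction e with
    | _ x y => simpa [cayleyGraph] using he⟩
  one_smul e := by
    apply Subtype.ext
    change e.1.map (1 * ·) = e.1
    simp
  mul_smul g h e := by
    apply Subtype.ext
    change e.1.map (g * h * ·) = (e.1.map (h * ·)).map (g * ·)
    simp [Sym2.map_map, mul_assoc]

theorem coe_smul_oneCube (g : RAAG Γ) (e : OneCube Γ) : (g • e).1 = e.1.map (g * ·) := rfl

theorem OppositeInTwoCube.smul {e f : OneCube Γ} (h : OppositeInTwoCube e f) (g : RAAG Γ) :
    OppositeInTwoCube (g • e) (g • f) := by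
  obtain ⟨a, b, c, d, ⟨v, w, hvw, rfl, rfl, rfl⟩, h⟩ := h
  refine ⟨g * a, _, _, _, ⟨v, w, hvw, rfl, rfl, rfl⟩, ?_⟩
  rcases h with ⟨h₁, h₂⟩ | ⟨h₁, h₂⟩
  · left
    simp [coe_smul_oneCube, h₁, h₂, mul_assoc]
  · right
    simp [coe_smul_oneCube, h₁, h₂, mul_assoc]

theorem parallel_smul (g : RAAG Γ) (e f : OneCube Γ) (h : parallelSetoid Γ e f) :
    parallelSetoid Γ (g • e) (g • f) := by
  change Relation.EqvGen _ _ _ at h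
  change Relation.EqvGen _ _ _
  induction h with
  | rel _ _ h => exact .rel _ _ (h.smul g)
  | refl _ => exact .refl _
  | symm _ _ _ ih => exact .symm _ _ ih
  | trans _ _ _ _ _ ih₁ ih₂ => exact .trans _ _ _ ih₁ ih₂

/-- The action of `A(Γ)` on the hyperplanes of `X(Γ)` induced by the action on `1`-cubes. -/
instance : MulAction (RAAG Γ) (Hyperplane Γ) where
  smul g := Quotient.map (g • ·) (parallel_smul g)
  one_smul h := by
    induction h using Quotient.inductionOn with
    | _ e => exact congrArg (Quotient.mk _) (one_smul _ e)
  mul_smul g g' h := by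
    induction h using Quotient.inductionOn with
    | _ e => exact congrArg (Quotient.mk _) (mul_smul g g' e)

instance [Countable V] : Countable (Hyperplane Γ) :=
  haveI : Countable (OneCube Γ) :=
    haveI : Countable (Sym2 (RAAG Γ)) := inferInstanceAs (Countable (Quot _))
    inferInstance
  inferInstanceAs (Countable (Quotient _))

/-- The set of hyperplanes carries the discrete Borel structure, and `𝓗^ℕ` the product one. -/
instance : MeasurableSpace (Hyperplane Γ) := ⊤

instance : DiscreteMeasurableSpace (Hyperplane Γ) := ⟨fun _ => trivial⟩

end RAAG

/-- An equivalence relation `E` on a standard Borel space `X` is a smooth Borel equivalence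
relation if it is Borel as a subset of `X × X` and there are a standard Borel space `Y` and a
Borel map `f : X → Y` with `x E y ↔ f x = f y`. -/
def IsSmoothBorelEquivalence {X : Type u} [MeasurableSpace X] [StandardBorelSpace X]
    (E : Setoid X) : Prop :=
  MeasurableSet {p : X × X | E p.1 p.2} ∧
    ∃ (Y : Type u) (_ : MeasurableSpace Y) (_ : StandardBorelSpace Y) (f : X → Y),
      Measurable f ∧ ∀ x y : X, E x y ↔ f x = f y

/-! The point is that the pointwise stabilizer of a sequence of hyperplanes is already the
stabilizer of a finite prefix (`exists_stabilizer_prefix`). Given this, two sequences are equivalent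
iff all their prefixes of equal length are, and prefixes range over countable discrete sets, so
choosing an orbit representative for each prefix gives a Borel reduction.

The finiteness comes from linearity. Sending `v` to a product of two reflections makes `A(Γ)` act on
`ℤ^(V × Bool)` through the dual Tits representation of a right-angled Coxeter group. Each hyperplane
receives a vector, equivariantly, with the same stabilizer as the hyperplane. Fixing a family of
vectors means fixing its span, and `ℤ^(V × Bool)` is Noetherian for finite `V`.

The hard part is that only the link subgroup of `v` fixes `linkVector` (`mem_linkSubgroup_of_rep`).
As in Tits' argument, signs of coordinates detect word length: a vector reached by a nonempty
geodesic has a positive coordinate, while `linkVector` has none. -/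

namespace RAAG

/-! ### Word distance in an orbit -/

section WordDist

variable {G X ι : Type*} [Group G] [MulAction G X]

/-- The least length of a word in the letters `a i` which moves `x₀` to `x`. -/
noncomputable def wordDist (a : ι → G) (x₀ x : X) : ℕ :=
  sInf {n | ∃ l : List ι, l.length = n ∧ (l.map a).prod • x₀ = x}

theorem wordDist_le (a : ι → G) (x₀ : X) (l : List ι) :
    wordDist a x₀ ((l.map a).prod • x₀) ≤ l.length :=
  Nat.sInf_le ⟨l, rfl, rfl⟩

/-- The points which are moved to from `x₀` by words in the letters `a i`. -/
def Reachable (a : ι → G) (x₀ x : X) : Prop := ∃ l : List ι, (l.map a).prod • x₀ = x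

theorem Reachable.exists_length_eq {a : ι → G} {x₀ x : X} (h : Reachable a x₀ x) :
    ∃ l : List ι, l.length = wordDist a x₀ x ∧ (l.map a).prod • x₀ = x := by
  obtain ⟨l, hl⟩ := h
  exact Nat.sInf_mem (s := {n | ∃ l : List ι, l.length = n ∧ (l.map a).prod • x₀ = x})
    ⟨_, l, rfl, hl⟩

theorem Reachable.smul {a : ι → G} {x₀ x : X} (h : Reachable a x₀ x) (i : ι) :
    Reachable a x₀ (a i • x) := by
  obtain ⟨l, rfl⟩ := h
  exact ⟨i :: l, by simp [mul_smul]⟩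

theorem Reachable.wordDist_smul_le {a : ι → G} {x₀ x : X} (h : Reachable a x₀ x) (i : ι) :
    wordDist a x₀ (a i • x) ≤ wordDist a x₀ x + 1 := by
  obtain ⟨l, hl, rfl⟩ := h.exists_length_eq
  rw [← hl]
  simpa [mul_smul] using wordDist_le a x₀ (i :: l)

/-- Reachability is essential: an unreachable point also has distance `0`, as `sInf ∅ = 0`. -/
theorem Reachable.eq_of_wordDist_eq_zero {a : ι → G} {x₀ x : X} (h : Reachable a x₀ x)
    (h₀ : wordDist a x₀ x = 0) : x = x₀ := by
  obtain ⟨l, hl, rfl⟩ := h.exists_length_eq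
  rw [h₀, List.length_eq_zero_iff] at hl
  simp [hl]

theorem Reachable.exists_smul_eq {a : ι → G} {x₀ x : X} (h : Reachable a x₀ x)
    (h₀ : wordDist a x₀ x ≠ 0) :
    ∃ i y, Reachable a x₀ y ∧ a i • y = x ∧ wordDist a x₀ y < wordDist a x₀ x := by
  obtain ⟨l, hl, hx⟩ := h.exists_length_eq
  cases l with
  | nil => exact absurd hl.symm h₀
  | cons i l =>
    refine ⟨i, (l.map a).prod • x₀, ⟨l, rfl⟩, by simpa [mul_smul] using hx, ?_⟩
    rw [← hl]
    exact Nat.lt_succ_of_le (wordDist_le a x₀ l)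

end WordDist

variable {V : Type u} (Γ : SimpleGraph V)

/-! ### The Tits representation and the sign invariant -/

section Representation

open Classical in
/-- The off-diagonal entries vanish for commuting letters and are `2` otherwise. -/
noncomputable def reflectionVector (i : V × Bool) : V × Bool → ℤ := fun j =>
  if i = j then -2 else if Γ.Adj i.1 j.1 then 0 else 2

theorem reflectionVector_self (i : V × Bool) : reflectionVector Γ i i = -2 := by
  simp [reflectionVector]

theorem reflectionVector_of_adj {i j : V × Bool} (h : Γ.Adj i.1 j.1) :
    reflectionVector Γ i j = 0 := by
  have : i ≠ j := by rintro rfl; exact h.ne rfl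
  simp [reflectionVector, this, h]

theorem reflectionVector_of_not_adj {i j : V × Bool} (hne : i ≠ j) (h : ¬ Γ.Adj i.1 j.1) :
    reflectionVector Γ i j = 2 := by
  simp [reflectionVector, hne, h]

/-- The reflections generating the dual of the geometric representation of a right-angled
Coxeter group. -/
noncomputable def reflection (i : V × Bool) : (V × Bool → ℤ) ≃ₗ[ℤ] (V × Bool → ℤ) :=
  LinearEquiv.ofInvolutive
    (LinearMap.id + (LinearMap.proj i).smulRight (reflectionVector Γ i)) (by
      intro φ
      ext j
      simp [reflectionVector_self]
      ring)

theorem reflection_apply (i j : V × Bool) (φ : V × Bool → ℤ) :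
    reflection Γ i φ j = φ j + φ i * reflectionVector Γ i j := by
  rfl

theorem reflection_mul_self (i : V × Bool) : reflection Γ i * reflection Γ i = 1 := by
  ext φ j
  simp [LinearEquiv.mul_apply, reflection_apply, reflectionVector_self]
  ring

theorem commute_reflection {i j : V × Bool} (h : Γ.Adj i.1 j.1) :
    Commute (reflection Γ i) (reflection Γ j) := by
  ext φ k
  simp [LinearEquiv.mul_apply, reflection_apply, reflectionVector_of_adj Γ h,
    reflectionVector_of_adj Γ h.symm]
  ring

/-- The representation of `A(Γ)` obtained from its embedding into a right-angled Coxeter group,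
which maps a generator to a product of two reflections. -/
noncomputable def rep : RAAG Γ →* ((V × Bool → ℤ) ≃ₗ[ℤ] (V × Bool → ℤ)) :=
  PresentedGroup.toGroup (f := fun v => reflection Γ (v, true) * reflection Γ (v, false)) (by
    rintro _ ⟨v, w, h, rfl⟩
    have hc : Commute (reflection Γ (v, true) * reflection Γ (v, false))
        (reflection Γ (w, true) * reflection Γ (w, false)) :=
      ((commute_reflection Γ h).mul_right (commute_reflection Γ h)).mul_left
        ((commute_reflection Γ h).mul_right (commute_reflection Γ h))
    simp only [map_mul, map_inv, FreeGroup.lift_apply_of]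
    rw [hc.eq]
    group)

theorem rep_gen (v : V) :
    rep Γ (gen Γ v) = reflection Γ (v, true) * reflection Γ (v, false) :=
  PresentedGroup.toGroup.of _

/-- The generators and their inverses. -/
def letter (i : V × Bool) : RAAG Γ := if i.2 then gen Γ i.1 else (gen Γ i.1)⁻¹

theorem letter_not (v : V) (b : Bool) : letter Γ (v, !b) = (letter Γ (v, b))⁻¹ := by
  cases b <;> simp [letter]

theorem rep_letter (v : V) (b : Bool) :
    rep Γ (letter Γ (v, b)) = reflection Γ (v, b) * reflection Γ (v, !b) := by
  have h (i) : (reflection Γ i)⁻¹ = reflection Γ i :=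
    inv_eq_of_mul_eq_one_right (reflection_mul_self Γ i)
  cases b <;> simp [letter, rep_gen, h]

theorem gen_commute {v w : V} (h : Γ.Adj v w) : Commute (gen Γ v) (gen Γ w) := by
  have h' : gen Γ v * gen Γ w * (gen Γ v)⁻¹ * (gen Γ w)⁻¹ = 1 :=
    PresentedGroup.one_of_mem ⟨v, w, h, rfl⟩
  rw [mul_inv_eq_one, mul_inv_eq_iff_eq_mul] at h'
  exact h'

theorem letter_commute {i j : V × Bool} (h : Γ.Adj i.1 j.1) :
    Commute (letter Γ i) (letter Γ j) := by
  have := gen_commute Γ h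
  unfold letter
  split_ifs
  · exact this
  · exact this.inv_right
  · exact this.inv_left
  · exact this.inv_inv

theorem rep_letter_apply_of_adj {v : V} {b : Bool} {j : V × Bool} (h : Γ.Adj v j.1)
    (φ : V × Bool → ℤ) : rep Γ (letter Γ (v, b)) φ j = φ j := by
  rw [rep_letter, LinearEquiv.mul_apply, reflection_apply, reflection_apply,
    reflectionVector_of_adj Γ (i := (v, b)) h, reflectionVector_of_adj Γ (i := (v, !b)) h]
  simp

theorem rep_letter_apply_of_not_adj {v : V} {b : Bool} {j : V × Bool} (hne : v ≠ j.1)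
    (h : ¬ Γ.Adj v j.1) (φ : V × Bool → ℤ) :
    rep Γ (letter Γ (v, b)) φ j = φ j + 2 * φ (v, b) + 6 * φ (v, !b) := by
  have hb : (v, !b) ≠ (v, b) := by simp
  rw [rep_letter, LinearEquiv.mul_apply, reflection_apply, reflection_apply, reflection_apply,
    reflectionVector_of_not_adj Γ (i := (v, b)) (j := j) (by rintro rfl; exact hne rfl) h,
    reflectionVector_of_not_adj Γ (i := (v, !b)) (j := j) (by rintro rfl; exact hne rfl) h,
    reflectionVector_of_not_adj Γ hb (Γ.irrefl)]
  ring

theorem rep_letter_apply_self (v : V) (b : Bool) (φ : V × Bool → ℤ) :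
    rep Γ (letter Γ (v, b)) φ (v, b) = - φ (v, b) - 2 * φ (v, !b) := by
  have hb : (v, !b) ≠ (v, b) := by simp
  rw [rep_letter, LinearEquiv.mul_apply, reflection_apply, reflection_apply,
    reflectionVector_of_not_adj Γ hb (Γ.irrefl), reflectionVector_self]
  ring

theorem rep_letter_apply_not (v : V) (b : Bool) (φ : V × Bool → ℤ) :
    rep Γ (letter Γ (v, b)) φ (v, !b) = 2 * φ (v, b) + 3 * φ (v, !b) := by
  have hb : (v, !b) ≠ (v, b) := by simp
  rw [rep_letter, LinearEquiv.mul_apply, reflection_apply, reflection_apply, reflection_apply,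
    reflectionVector_of_not_adj Γ hb (Γ.irrefl),
    reflectionVector_of_not_adj Γ hb.symm (Γ.irrefl), reflectionVector_self]
  ring

/-- What the signs of the coordinates of `φ` say about the position of `x` relative to `x₀`. -/
structure Governs {X : Type*} [MulAction (RAAG Γ) X] (x₀ x : X) (φ : V × Bool → ℤ) : Prop where
  smul_eq : ∀ i, φ i = 0 → letter Γ i • x = x
  wordDist_lt : ∀ i, 0 < φ i →
    wordDist (letter Γ) x₀ ((letter Γ i)⁻¹ • x) < wordDist (letter Γ) x₀ x
  le_neg : ∀ i j, i ≠ j → ¬ Γ.Adj i.1 j.1 → 0 < φ i → φ j ≤ - φ i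

variable {Γ}

/-- Inductive step of the sign argument. A lengthening letter `(v, b)` forces `φ (v, !b) < 0`. Its
action then leaves the coordinates of commuting letters unchanged, makes coordinate `(v, b)`
positive, and pushes every other coordinate below the negative of that one. -/
theorem Governs.letter_smul {X : Type*} [MulAction (RAAG Γ) X] {x₀ x : X} {φ : V × Bool → ℤ}
    (h : Governs Γ x₀ x φ) (hx : Reachable (letter Γ) x₀ x) (i : V × Bool)
    (hi : wordDist (letter Γ) x₀ x < wordDist (letter Γ) x₀ (letter Γ i • x)) :
    Governs Γ x₀ (letter Γ i • x) (rep Γ (letter Γ i) φ) ∧ 0 < rep Γ (letter Γ i) φ i := by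
  obtain ⟨v, b⟩ := i
  have hb : (v, !b) ≠ (v, b) := by simp
  have h₁ : φ (v, b) ≠ 0 := fun h₀ => by
    rw [h.smul_eq _ h₀] at hi
    exact lt_irrefl _ hi
  have h₂ : φ (v, !b) < 0 := by
    rcases lt_trichotomy (φ (v, !b)) 0 with h₀ | h₀ | h₀
    · exact h₀
    · have := h.smul_eq _ h₀
      rw [letter_not, inv_smul_eq_iff] at this
      rw [← this] at hi
      exact absurd hi (lt_irrefl _)
    · have := h.wordDist_lt _ h₀
      rw [letter_not, inv_inv] at this
      omega
  -- With `φ (v, !b) < 0`, this bound drives all the estimates below; for instance the new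
  -- coordinate `- φ (v, b) - 2 * φ (v, !b)` is at least `- φ (v, !b)`.
  have h₃ : φ (v, b) ≤ - φ (v, !b) := by
    by_cases h₀ : 0 < φ (v, b)
    · have := h.le_neg (v, b) (v, !b) hb.symm Γ.irrefl h₀
      omega
    · omega
  have hself := rep_letter_apply_self Γ v b φ
  have hnot := rep_letter_apply_not Γ v b φ
  have hfar (j : V × Bool) (hne : v ≠ j.1) (hj : ¬ Γ.Adj v j.1) :
      rep Γ (letter Γ (v, b)) φ j ≤ - rep Γ (letter Γ (v, b)) φ (v, b) := by
    rw [rep_letter_apply_of_not_adj Γ hne hj, hself]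
    by_cases h₀ : 0 < φ j
    · have := h.le_neg j (v, !b) (by rintro rfl; exact hne rfl) (fun h' => hj h'.symm) h₀
      omega
    · omega
  have hpos : 0 < rep Γ (letter Γ (v, b)) φ (v, b) := by
    by_cases h₀ : 0 < φ (v, b) <;> omega
  have hneg : rep Γ (letter Γ (v, b)) φ (v, !b) ≤ - rep Γ (letter Γ (v, b)) φ (v, b) := by
    omega
  have hcases (j : V × Bool) : j = (v, b) ∨ Γ.Adj v j.1 ∨
      rep Γ (letter Γ (v, b)) φ j ≤ - rep Γ (letter Γ (v, b)) φ (v, b) := by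
    obtain ⟨w, b'⟩ := j
    by_cases hw : v = w
    · subst hw
      rcases Bool.eq_or_eq_not b' b with rfl | rfl
      · exact .inl rfl
      · exact .inr (.inr hneg)
    · by_cases hj : Γ.Adj v w
      · exact .inr (.inl hj)
      · exact .inr (.inr (hfar _ hw hj))
  refine ⟨⟨fun j hj => ?_, fun j hj => ?_, fun j k hjk hadj hj => ?_⟩, hpos⟩
  · rcases hcases j with rfl | h' | h'
    · omega
    · rw [rep_letter_apply_of_adj Γ h'] at hj
      rw [← mul_smul, (letter_commute Γ (i := j) (j := (v, b)) h'.symm).eq, mul_smul,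
        h.smul_eq _ hj]
    · omega
  · rcases hcases j with rfl | h' | h'
    · rwa [inv_smul_smul]
    · rw [rep_letter_apply_of_adj Γ h'] at hj
      have hlt := h.wordDist_lt _ hj
      obtain ⟨w, b'⟩ := j
      rw [← mul_smul, (letter_commute Γ (i := (w, b')) (j := (v, b)) h'.symm).inv_left.eq,
        mul_smul]
      rw [← letter_not] at hlt ⊢
      have := (hx.smul (w, !b')).wordDist_smul_le (v, b)
      omega
    · omega
  · rcases hcases j with rfl | h' | h'
    · rcases hcases k with rfl | h'' | h''
      · exact absurd rfl hjk
      · exact absurd h'' hadj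
      · exact h''
    · rw [rep_letter_apply_of_adj Γ h'] at hj ⊢
      have hk : φ k ≤ - φ j := h.le_neg j k hjk hadj hj
      rcases hcases k with rfl | h'' | h''
      · exact absurd h'.symm hadj
      · rwa [rep_letter_apply_of_adj Γ h'']
      · obtain ⟨w, b'⟩ := k
        by_cases hw : v = w
        · subst hw
          exact absurd h'.symm hadj
        · by_cases hw' : Γ.Adj v w
          · rwa [rep_letter_apply_of_adj Γ hw']
          · rw [rep_letter_apply_of_not_adj Γ hw hw']
            rw [hself] at hpos
            omega
    · omega

/-- Induction along a geodesic from `x₀` to `x`. The element `g` is the product of the geodesic's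
letters, so it is determined only up to the stabilizer of `x₀`; its last applied letter supplies the
positive coordinate. -/
theorem exists_governs {X : Type*} [MulAction (RAAG Γ) X] {x₀ : X} {φ₀ : V × Bool → ℤ}
    (h₀ : Governs Γ x₀ x₀ φ₀) (n : ℕ) (x : X) (hx : Reachable (letter Γ) x₀ x)
    (hn : wordDist (letter Γ) x₀ x = n) :
    ∃ g : RAAG Γ, g • x₀ = x ∧ Governs Γ x₀ x (rep Γ g φ₀) ∧
      (n ≠ 0 → ∃ i, 0 < rep Γ g φ₀ i) := by
  induction n using Nat.strong_induction_on generalizing x with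
  | _ n ih =>
    by_cases hn₀ : n = 0
    · subst hn₀
      obtain rfl := hx.eq_of_wordDist_eq_zero hn
      exact ⟨1, by simp, by simpa using h₀, fun h => absurd rfl h⟩
    · obtain ⟨i, y, hy, rfl, hlt⟩ := hx.exists_smul_eq (hn ▸ hn₀)
      obtain ⟨g, rfl, hg, -⟩ := ih _ (hn ▸ hlt) y hy rfl
      obtain ⟨h₁, h₂⟩ := hg.letter_smul hy i hlt
      refine ⟨letter Γ i * g, mul_smul _ _ _, ?_, fun _ => ⟨i, ?_⟩⟩
      · simpa [LinearEquiv.mul_apply] using h₁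
      · simpa [LinearEquiv.mul_apply] using h₂

theorem reachable_letter {X : Type*} [MulAction (RAAG Γ) X] (x₀ : X) (g : RAAG Γ) :
    Reachable (letter Γ) x₀ (g • x₀) := by
  have hg : g ∈ Subgroup.closure (Set.range (gen Γ)) := by
    have := PresentedGroup.closure_range_of {r : FreeGroup V | ∃ v w : V, Γ.Adj v w ∧
      r = FreeGroup.of v * FreeGroup.of w * (FreeGroup.of v)⁻¹ * (FreeGroup.of w)⁻¹}
    change g ∈ Subgroup.closure (Set.range PresentedGroup.of)
    rw [this]
    trivial
  induction hg using Subgroup.closure_induction_left with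
  | one => exact ⟨[], by simp⟩
  | mul_left s hs y _ ih =>
    obtain ⟨v, rfl⟩ := hs
    simpa [letter, mul_smul] using ih.smul (v, true)
  | inv_mul_cancel s hs y _ ih =>
    obtain ⟨v, rfl⟩ := hs
    simpa [letter, mul_smul] using ih.smul (v, false)

end Representation

/-! ### Stabilizer of the link vector -/

section Link

/-- The parabolic subgroup generated by the link of a vertex. -/
def linkSubgroup (v : V) : Subgroup (RAAG Γ) := Subgroup.closure (gen Γ '' {w | Γ.Adj v w})

open Classical in
/-- A vector of the representation whose stabilizer is the parabolic subgroup of the link. -/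
noncomputable def linkVector (v : V) : V × Bool → ℤ := fun j => if Γ.Adj v j.1 then 0 else -1

variable {Γ}

theorem rep_linkVector_of_mem {v : V} {g : RAAG Γ} (hg : g ∈ linkSubgroup Γ v) :
    rep Γ g (linkVector Γ v) = linkVector Γ v := by
  induction hg using Subgroup.closure_induction with
  | mem x hx =>
    obtain ⟨w, hw, rfl⟩ := hx
    have (b : Bool) : linkVector Γ v (w, b) = 0 := if_pos hw
    ext j
    simp [rep_gen, LinearEquiv.mul_apply, reflection_apply, this]
  | one => simp
  | mul x y _ _ hx hy => rw [map_mul, LinearEquiv.mul_apply, hy, hx]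
  | inv x _ hx =>
    rw [map_inv]
    exact (LinearEquiv.symm_apply_eq _).2 hx.symm

/-- The sign argument is run on the cosets of the link subgroup, from the trivial coset `x₀`. If `g
• x₀ ≠ x₀`, a geodesic representative `k` of the coset of `g` would give a vector with a positive
coordinate; but `k` differs from `g` by a link element, so it too fixes the nonpositive
`linkVector`. -/
theorem mem_linkSubgroup_of_rep {v : V} {g : RAAG Γ}
    (hg : rep Γ g (linkVector Γ v) = linkVector Γ v) : g ∈ linkSubgroup Γ v := by
  set x₀ : RAAG Γ ⧸ linkSubgroup Γ v := ((1 : RAAG Γ) : RAAG Γ ⧸ linkSubgroup Γ v) with hx₀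
  have hmem {k : RAAG Γ} : k • x₀ = x₀ ↔ k ∈ linkSubgroup Γ v := by
    rw [hx₀, MulAction.Quotient.smul_coe, eq_comm, QuotientGroup.eq]
    simp
  have hle (i) : linkVector Γ v i ≤ 0 := by
    unfold linkVector
    split_ifs <;> simp
  have h₀ : Governs Γ x₀ x₀ (linkVector Γ v) := by
    refine ⟨fun i hi => ?_, fun i hi => absurd hi (hle i).not_gt,
      fun i _ _ _ hi => absurd hi (hle i).not_gt⟩
    have hi' : Γ.Adj v i.1 := by
      by_contra h
      simp [linkVector, h] at hi
    have : gen Γ i.1 ∈ linkSubgroup Γ v := Subgroup.subset_closure ⟨_, hi', rfl⟩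
    rw [hmem, letter]
    split_ifs
    · exact this
    · exact inv_mem this
  obtain ⟨k, hk, -, hpos⟩ := exists_governs h₀ _ (g • x₀) (reachable_letter x₀ g) rfl
  have hgk : k⁻¹ * g ∈ linkSubgroup Γ v := by
    rw [← hmem, mul_smul, ← hk, inv_smul_smul]
  have hkv : rep Γ k (linkVector Γ v) = linkVector Γ v := by
    have := rep_linkVector_of_mem hgk
    rw [map_mul, LinearEquiv.mul_apply, hg, map_inv] at this
    exact ((LinearEquiv.symm_apply_eq _).1 this).symm
  rw [← hmem]
  refine (reachable_letter x₀ g).eq_of_wordDist_eq_zero ?_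
  by_contra hne
  obtain ⟨i, hi⟩ := hpos hne
  rw [hkv] at hi
  exact (hle i).not_gt hi

end Link

/-! ### Hyperplanes as vectors -/

section Hyperplane

/-- The exponent sum of an element, a generator `v` being counted with weight `f v`. -/
noncomputable def exponent (f : V → ℤ) : RAAG Γ →* Multiplicative ℤ :=
  PresentedGroup.toGroup (f := fun v => Multiplicative.ofAdd (f v)) (by
    rintro _ ⟨v, w, -, rfl⟩
    simp only [map_mul, map_inv, FreeGroup.lift_apply_of]
    rw [mul_comm (Multiplicative.ofAdd (f v))]
    group)

theorem exponent_gen (f : V → ℤ) (v : V) :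
    exponent Γ f (gen Γ v) = Multiplicative.ofAdd (f v) :=
  PresentedGroup.toGroup.of _

theorem gen_injective : Function.Injective (gen Γ) := by
  classical
  intro v w h
  have := congrArg (exponent Γ (Pi.single v 1)) h
  rw [exponent_gen, exponent_gen] at this
  by_contra hne
  simp [Ne.symm hne] at this

theorem gen_mul_gen_ne_one (v w : V) : gen Γ v * gen Γ w ≠ 1 := by
  intro h
  have := congrArg (exponent Γ fun _ => 1) h
  rw [map_mul, exponent_gen, exponent_gen, map_one (exponent Γ _), ← ofAdd_add] at this
  exact absurd this (by decide)

theorem gen_ne_one (v : V) : gen Γ v ≠ 1 := by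
  intro h
  exact gen_mul_gen_ne_one Γ v v (by simp [h])

/-- The edge from `g` to `gv`. -/
def edge (g : RAAG Γ) (v : V) : OneCube Γ :=
  ⟨s(g, g * gen Γ v), by simp [cayleyGraph, SimpleGraph.mulCayley_adj, gen_ne_one]⟩

theorem exists_edge_eq (e : OneCube Γ) : ∃ p : RAAG Γ × V, edge Γ p.1 p.2 = e := by
  obtain ⟨e, he⟩ := e
  induction e with
  | _ x y =>
    have h := he
    simp only [cayleyGraph, SimpleGraph.mem_edgeSet, SimpleGraph.mulCayley_adj'] at h
    obtain ⟨-, _, ⟨v, rfl⟩, rfl | rfl⟩ := h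
    · exact ⟨(x, v), rfl⟩
    · exact ⟨(y, v), Subtype.ext Sym2.eq_swap⟩

/-- Edges have a canonical orientation and label, because no product of two generators is trivial
and generators are distinct. Hence `edgeVector` does not depend on its choices. -/
theorem eq_of_sym2_eq {g g' : RAAG Γ} {v v' : V}
    (h : s(g, g * gen Γ v) = s(g', g' * gen Γ v')) : g = g' ∧ v = v' := by
  rw [Sym2.eq_iff] at h
  rcases h with ⟨rfl, h⟩ | ⟨rfl, h⟩
  · exact ⟨rfl, gen_injective Γ (mul_left_cancel h)⟩
  · rw [mul_assoc, mul_eq_left] at h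
    exact absurd h (gen_mul_gen_ne_one Γ _ _)

theorem smul_edge (k g : RAAG Γ) (v : V) : k • edge Γ g v = edge Γ (k * g) v :=
  Subtype.ext (by simp [coe_smul_oneCube, edge, mul_assoc])

/-- The vector attached to an edge; it depends only on the hyperplane dual to the edge. -/
noncomputable def edgeVector (e : OneCube Γ) : V × Bool → ℤ :=
  rep Γ (exists_edge_eq Γ e).choose.1 (linkVector Γ (exists_edge_eq Γ e).choose.2)

theorem edgeVector_eq {e : OneCube Γ} {g : RAAG Γ} {v : V} (h : e.1 = s(g, g * gen Γ v)) :
    edgeVector Γ e = rep Γ g (linkVector Γ v) := by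
  have h' := congrArg Subtype.val (exists_edge_eq Γ e).choose_spec
  obtain ⟨h₁, h₂⟩ := eq_of_sym2_eq Γ (h'.trans h)
  rw [edgeVector, h₁, h₂]

theorem rep_mul_gen_linkVector (g : RAAG Γ) {v w : V} (h : Γ.Adj v w) :
    rep Γ (g * gen Γ w) (linkVector Γ v) = rep Γ g (linkVector Γ v) := by
  rw [map_mul, LinearEquiv.mul_apply,
    rep_linkVector_of_mem (Subgroup.subset_closure ⟨w, h, rfl⟩)]

theorem edgeVector_eq_of_opposite {e f : OneCube Γ} (h : OppositeInTwoCube e f) :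
    edgeVector Γ e = edgeVector Γ f := by
  obtain ⟨a, b, c, d, ⟨v, w, hvw, rfl, rfl, rfl⟩, ⟨h₁, h₂⟩ | ⟨h₁, h₂⟩⟩ := h
  · rw [mul_assoc, (gen_commute Γ hvw).eq, ← mul_assoc] at h₂
    rw [edgeVector_eq Γ h₁, edgeVector_eq Γ h₂, rep_mul_gen_linkVector Γ a hvw]
  · rw [edgeVector_eq Γ h₁, edgeVector_eq Γ h₂, rep_mul_gen_linkVector Γ a hvw.symm]

theorem edgeVector_eq_of_parallel {e f : OneCube Γ} (h : parallelSetoid Γ e f) :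
    edgeVector Γ e = edgeVector Γ f := by
  change Relation.EqvGen _ _ _ at h
  induction h with
  | rel _ _ h => exact edgeVector_eq_of_opposite Γ h
  | refl _ => rfl
  | symm _ _ _ ih => exact ih.symm
  | trans _ _ _ _ _ ih₁ ih₂ => exact ih₁.trans ih₂

/-- An equivariant map from the hyperplanes to the representation. -/
noncomputable def hyperplaneVector : Hyperplane Γ → V × Bool → ℤ :=
  Quotient.lift (edgeVector Γ) fun _ _ h => edgeVector_eq_of_parallel Γ h

/-- The hyperplane dual to the edge from `g` to `gv`. -/
def dual (g : RAAG Γ) (v : V) : Hyperplane Γ := Quotient.mk _ (edge Γ g v)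

theorem exists_hyperplane_eq (h : Hyperplane Γ) :
    ∃ g v, h = dual Γ g v := by
  induction h using Quotient.inductionOn with
  | _ e =>
    obtain ⟨⟨g, v⟩, rfl⟩ := exists_edge_eq Γ e
    exact ⟨g, v, rfl⟩

theorem smul_dual (k g : RAAG Γ) (v : V) :
    k • dual Γ g v = dual Γ (k * g) v :=
  congrArg (Quotient.mk _) (smul_edge Γ k g v)

theorem hyperplaneVector_dual (g : RAAG Γ) (v : V) :
    hyperplaneVector Γ (dual Γ g v) = rep Γ g (linkVector Γ v) :=
  edgeVector_eq Γ rfl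

theorem hyperplaneVector_smul (k : RAAG Γ) (h : Hyperplane Γ) :
    hyperplaneVector Γ (k • h) = rep Γ k (hyperplaneVector Γ h) := by
  obtain ⟨g, v, rfl⟩ := exists_hyperplane_eq Γ h
  rw [smul_dual, hyperplaneVector_dual, hyperplaneVector_dual, map_mul,
    LinearEquiv.mul_apply]

theorem smul_dual_one {v : V} {k : RAAG Γ} (hk : k ∈ linkSubgroup Γ v) :
    k • dual Γ 1 v = dual Γ 1 v := by
  change k ∈ MulAction.stabilizer (RAAG Γ) (dual Γ 1 v)
  refine (Subgroup.closure_le _).2 ?_ hk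
  rintro _ ⟨w, hw, rfl⟩
  change gen Γ w • dual Γ 1 v = _
  rw [smul_dual]
  refine Quotient.sound (Relation.EqvGen.symm _ _ (Relation.EqvGen.rel _ _ ?_))
  refine ⟨1, _, _, _, ⟨v, w, hw, rfl, rfl, rfl⟩, .inl ⟨rfl, ?_⟩⟩
  simp [edge, (gen_commute Γ hw).eq]

/-- Conjugation reduces this to an edge at `1`. Only stabilizers are compared: vertices with equal
links give different hyperplanes with the same vector. -/
theorem smul_hyperplane_eq {k : RAAG Γ} {h : Hyperplane Γ}
    (hk : rep Γ k (hyperplaneVector Γ h) = hyperplaneVector Γ h) : k • h = h := by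
  obtain ⟨g, v, rfl⟩ := exists_hyperplane_eq Γ h
  rw [hyperplaneVector_dual, ← LinearEquiv.mul_apply, ← map_mul] at hk
  have hmem : g⁻¹ * (k * g) ∈ linkSubgroup Γ v := by
    apply mem_linkSubgroup_of_rep
    rw [map_mul, LinearEquiv.mul_apply, hk, map_inv]
    exact (LinearEquiv.symm_apply_eq _).2 rfl
  have h₁ := smul_dual_one Γ hmem
  have h₂ := smul_dual Γ g 1 v
  rw [mul_one] at h₂
  rw [← h₂, ← mul_smul, ← smul_left_cancel_iff g⁻¹, ← mul_smul, inv_smul_smul, h₁]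

/-- The pointwise stabilizer of a sequence of hyperplanes is that of a finite initial segment. -/
theorem exists_stabilizer_prefix [Finite V] (h : ℕ → Hyperplane Γ) :
    ∃ N, ∀ k : RAAG Γ, (∀ n < N, k • h n = h n) → k • h = h := by
  -- The spans of the vectors of the prefixes form an ascending chain, which stabilizes at some `N`;
  -- an element fixing the first `N` vectors then fixes all of them.
  let S : ℕ →o Submodule ℤ (V × Bool → ℤ) :=
    ⟨fun N => Submodule.span ℤ ((fun n => hyperplaneVector Γ (h n)) '' Set.Iio N),
      fun _ _ hMN => Submodule.span_mono (Set.image_mono (Set.Iio_subset_Iio hMN))⟩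
  obtain ⟨N, hN⟩ := monotone_stabilizes_iff_noetherian.2
    (inferInstance : IsNoetherian ℤ (V × Bool → ℤ)) S
  refine ⟨N, fun k hk => funext fun n => smul_hyperplane_eq Γ ?_⟩
  have hmem : hyperplaneVector Γ (h n) ∈ S N := by
    rcases lt_or_ge n N with hn | hn
    · exact Submodule.subset_span ⟨n, hn, rfl⟩
    · rw [hN (n + 1) (by omega)]
      exact Submodule.subset_span ⟨n, Nat.lt_succ_self n, rfl⟩
  refine Submodule.span_induction (p := fun x _ => rep Γ k x = x) ?_ (map_zero _) ?_ ?_ hmem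
  · rintro _ ⟨m, hm, rfl⟩
    exact (hyperplaneVector_smul Γ k (h m)).symm.trans (congrArg _ (hk m hm))
  · intro x y _ _ hx hy
    rw [map_add, hx, hy]
  · intro a x _ hx
    rw [map_smul, hx]

end Hyperplane

end RAAG

/-! ### From finite prefixes to smoothness -/

section Smooth

variable {G X : Type u} [Group G] [MulAction G X]

/-- A representative of the orbit of each finite initial segment of a sequence. -/
noncomputable def prefixOrbits (G : Type u) [Group G] [MulAction G X] (x : ℕ → X) (n : ℕ) :
    Fin n → X :=
  (Quotient.mk (MulAction.orbitRel G (Fin n → X)) fun i => x i).out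

theorem orbitRel_iff_prefixOrbits
    (hG : ∀ x : ℕ → X, ∃ N, ∀ g : G, (∀ n < N, g • x n = x n) → g • x = x) (x y : ℕ → X) :
    MulAction.orbitRel G (ℕ → X) x y ↔ prefixOrbits G x = prefixOrbits G y := by
  have key : prefixOrbits G x = prefixOrbits G y ↔
      ∀ n, ∃ g : G, ∀ i < n, g • y i = x i := by
    rw [funext_iff]
    refine forall_congr' fun n => ?_
    rw [prefixOrbits, prefixOrbits, Quotient.out_inj, Quotient.eq]
    change (fun i : Fin n => x i) ∈ MulAction.orbit G (fun i : Fin n => y i) ↔ _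
    rw [MulAction.mem_orbit_iff]
    refine exists_congr fun g => ?_
    rw [funext_iff]
    exact ⟨fun h i hi => h ⟨i, hi⟩, fun h i => h i i.2⟩
  rw [key]
  constructor
  · rintro ⟨g, hg⟩ n
    exact ⟨g, fun i _ => congrFun hg i⟩
  · intro h
    obtain ⟨N, hN⟩ := hG y
    obtain ⟨g, hg⟩ := h N
    refine ⟨g, funext fun m => ?_⟩
    -- The element `k` may vary with `m`, but `g⁻¹ * k` fixes the first `N` terms of `y`, hence all
    -- of `y`; so `g` agrees with `k` on `y m`.
    obtain ⟨k, hk⟩ := h (max N (m + 1))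
    have := hN (g⁻¹ * k) fun n hn => by
      rw [mul_smul, hk n (lt_max_of_lt_left hn), ← hg n hn, inv_smul_smul]
    have hm := congrFun this m
    rw [Pi.smul_apply, mul_smul, inv_smul_eq_iff, hk m (by simp)] at hm
    exact hm.symm

theorem isSmoothBorelEquivalence_orbitRel [Countable X] [MeasurableSpace X]
    [DiscreteMeasurableSpace X]
    (hG : ∀ x : ℕ → X, ∃ N, ∀ g : G, (∀ n < N, g • x n = x n) → g • x = x) :
    IsSmoothBorelEquivalence (MulAction.orbitRel G (ℕ → X)) := by
  have hmeas : Measurable (prefixOrbits G : (ℕ → X) → ∀ n, Fin n → X) := by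
    refine measurable_pi_lambda _ fun n => ?_
    have h₁ : Measurable fun x : ℕ → X => fun i : Fin n => x i :=
      measurable_pi_lambda _ fun i => measurable_pi_apply _
    exact (Measurable.of_discrete (f := fun z : Fin n → X =>
      (Quotient.mk (MulAction.orbitRel G (Fin n → X)) z).out)).comp h₁
  refine ⟨?_, ∀ n, Fin n → X, inferInstance, inferInstance, prefixOrbits G, hmeas,
    orbitRel_iff_prefixOrbits hG⟩
  -- The reduction also shows that the relation is Borel, as the set where two Borel maps agree.
  simp only [orbitRel_iff_prefixOrbits hG]
  exact measurableSet_eq_fun (hmeas.comp measurable_fst) (hmeas.comp measurable_snd)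

end Smooth

theorem lemma3p6 {V : Type u} [Finite V] (Γ : SimpleGraph V) :
    IsSmoothBorelEquivalence (MulAction.orbitRel (RAAG Γ) (ℕ → RAAG.Hyperplane Γ)) :=
  isSmoothBorelEquivalence_orbitRel (RAAG.exists_stabilizer_prefix Γ)
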